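/- Let $n\ge 0$, let $K\subseteq\mathbb{R}^n$ be a nonempty closed convex set (not necessarily bounded) with diameter $d=\sup\{\|\theta-\theta'\|:\theta,\theta'\in K\}\in[0,\infty]$, where $\|\cdot\|$ is the Euclidean norm, and let $\sigma>0$. We observe $Y=\mu+\xi$ with $\mu\in K$ and $\xi\sim N(0,\sigma^2\mathbb{I}_n)$. Let $\hat\mu=\operatorname{argmin}_{\nu\in K}\|Y-\nu\|^2$ be the least squares estimator and let $$\varepsilon_K=\varepsilon_K(\sigma):=\Big(\sup_{\mu\in K}\mathbb{E}\|\hat\mu-\mu\|^2\Big)^{1/2}$$ be its worst case rate. For $\mu\in K$ and $\varepsilon\ge 0$ let $$w_\mu(\varepsilon)=\mathbb{E}\sup\{\langle x,t\rangle: t\in K,\ \|t-\mu\|\le\varepsilon\},\qquad x\sim N(0,\mathbb{I}_n),$$ be the local Gaussian width. For fixed constants $C>1>c>0$ define $$\overline\varepsilon:=\sup\Big\{\varepsilon\ge 0:\ \sup_{\mu\in K}\big[w_\mu(C\varepsilon)-w_\mu(c\varepsilon)\big]\ge\frac{(C^2-c^2)\varepsilon^2}{2\sigma}\Big\}.$$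 **Theorem.** For all $C>1>c>0$ there is a constant $\kappa_0>0$, depending only on $C$ and $c$, such that for every $\kappa\ge\kappa_0$ there are constants $a,b>0$, depending only on $C$, $c$ and $\kappa$, such that for all $n$, $K$ and $\sigma$ as above: 1. if $\overline\varepsilon\ge\kappa\sigma$, then $a\,\overline\varepsilon\le\varepsilon_K\le b\,\overline\varepsilon$; 2. if $\overline\varepsilon<\kappa\sigma$, then $a\min(\sigma,d)\le\varepsilon_K\le b\min(\sigma,d)$. -/

import Mathlib

open MeasureTheory ProbabilityTheory
open scoped ENNReal NNReal

/-- The Gaussian width `w(T) = 𝔼 sup_{t ∈ T} ⟨x, t⟩`, `x ∼ N(0, I_n)`. For `T` bounded and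
nonempty (the only case used below) the supremum is finite and integrable in `x`. -/
noncomputable def gaussianWidth {n : ℕ} (T : Set (EuclideanSpace ℝ (Fin n))) : ℝ :=
  ∫ x, sSup ((fun t => inner ℝ x t) '' T) ∂(stdGaussian (EuclideanSpace ℝ (Fin n)))

/-- The local Gaussian width `w_{K,μ}(ε) = w(B(μ, ε) ∩ K)`, with `B(μ, ε)` the closed ball. -/
noncomputable def localWidth {n : ℕ} (K : Set (EuclideanSpace ℝ (Fin n)))
    (μ : EuclideanSpace ℝ (Fin n)) (ε : ℝ) : ℝ :=
  gaussianWidth (Metric.closedBall μ ε ∩ K)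

/-- `ν` minimizes `‖y - ν‖²` over `K`. -/
def IsLeastSquares {n : ℕ} (K : Set (EuclideanSpace ℝ (Fin n)))
    (y ν : EuclideanSpace ℝ (Fin n)) : Prop :=
  ν ∈ K ∧ ∀ ν' ∈ K, ‖y - ν‖ ^ 2 ≤ ‖y - ν'‖ ^ 2

/-- The least squares estimator `μ̂(y) = argmin_{ν ∈ K} ‖y - ν‖²`. The minimizer exists and is
unique when `K` is nonempty, closed and convex: see `lse_spec` and `IsLeastSquares.eq_lse`. -/
noncomputable def lse {n : ℕ} (K : Set (EuclideanSpace ℝ (Fin n)))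
    (y : EuclideanSpace ℝ (Fin n)) : EuclideanSpace ℝ (Fin n) :=
  Classical.epsilon (IsLeastSquares K y)

theorem lse_spec {n : ℕ} {K : Set (EuclideanSpace ℝ (Fin n))} (hne : K.Nonempty)
    (hcl : IsClosed K) (y : EuclideanSpace ℝ (Fin n)) : IsLeastSquares K y (lse K y) := by
  obtain ⟨ν, hν, h⟩ := hcl.exists_infDist_eq_dist hne y
  refine Classical.epsilon_spec (p := IsLeastSquares K y) ⟨ν, hν, fun ν' hν' => ?_⟩
  have := Metric.infDist_le_dist_of_mem (x := y) hν'
  rw [h, dist_eq_norm, dist_eq_norm] at this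
  gcongr

theorem IsLeastSquares.eq_lse {n : ℕ} {K : Set (EuclideanSpace ℝ (Fin n))}
    (hcl : IsClosed K) (hcv : Convex ℝ K) {y ν : EuclideanSpace ℝ (Fin n)}
    (h : IsLeastSquares K y ν) : ν = lse K y := by
  have h' := lse_spec ⟨ν, h.1⟩ hcl y
  set η := lse K y
  have hm := h.2 _ (hcv h.1 h'.1 (by norm_num : (0 : ℝ) ≤ 1 / 2)
    (by norm_num : (0 : ℝ) ≤ 1 / 2) (by norm_num))
  have hle := h'.2 _ h.1
  have hpar := parallelogram_law_with_norm ℝ (y - ν) (y - η)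
  have e1 : y - ((1 / 2 : ℝ) • ν + (1 / 2 : ℝ) • η) = (1 / 2 : ℝ) • ((y - ν) + (y - η)) := by
    module
  have e2 : (y - ν) - (y - η) = -(ν - η) := by abel
  rw [e1, norm_smul, mul_pow] at hm
  rw [e2, norm_neg] at hpar
  norm_num at hm
  have : ‖ν - η‖ = 0 := by nlinarith [norm_nonneg (ν - η), norm_nonneg (y - ν)]
  exact sub_eq_zero.1 (norm_eq_zero.1 this)

/-- The risk `𝔼 ‖μ̂(Y) - μ‖²` of the least squares estimator at `μ`, where `Y = μ + ξ` with
`ξ = σ x`, `x ∼ N(0, I_n)`, i.e. `ξ ∼ N(0, σ² I_n)`. -/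
noncomputable def lseRisk {n : ℕ} (K : Set (EuclideanSpace ℝ (Fin n))) (σ : ℝ)
    (μ : EuclideanSpace ℝ (Fin n)) : ℝ≥0∞ :=
  ∫⁻ x, ENNReal.ofReal (‖lse K (μ + σ • x) - μ‖ ^ 2) ∂(stdGaussian (EuclideanSpace ℝ (Fin n)))

/-- The worst case rate `ε_K(σ)`: the square root of `sup_{μ ∈ K} 𝔼 ‖μ̂ - μ‖²`. -/
noncomputable def lseWorstRate {n : ℕ} (K : Set (EuclideanSpace ℝ (Fin n))) (σ : ℝ) : ℝ≥0∞ :=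
  (⨆ μ ∈ K, lseRisk K σ μ) ^ (1 / 2 : ℝ)

/-- The supremum of the `ε ≥ 0` such that
`sup_{μ ∈ K} [w_μ(C ε) - w_μ(c ε)] ≥ (C² - c²) ε² / (2 σ)`. -/
noncomputable def widthGapRate {n : ℕ} (K : Set (EuclideanSpace ℝ (Fin n))) (C c σ : ℝ) : ℝ≥0∞ :=
  ⨆ (ε : ℝ) (_ : 0 ≤ ε ∧ (((C ^ 2 - c ^ 2) * ε ^ 2 / (2 * σ) : ℝ) : EReal) ≤
    ⨆ μ ∈ K, ((localWidth K μ (C * ε) - localWidth K μ (c * ε) : ℝ) : EReal)),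
    ENNReal.ofReal ε

/-! Fix `μ ∈ K` and let `F u` be the support function of `B(μ, u) ∩ K` at the noise vector `x`.
Convexity of `K` makes `F` concave in `u` (`supportFn_closedBall_inter_concave`). Optimality of the
projection then ties its error `r` to the gap `F t - F s`: if `r ≥ t`, then `r` is at most `2σ / (t
- s)` times the gap (`lse_error_le_of_ge`); if `r < s`, the gap is at most `(t - s) r / σ`
(`supportFn_gap_le_of_lse_error_lt`).

The gap has mean `w_μ(t) - w_μ(s)` and variance at most `10 (s² + t²)`, independent of dimension, by
a Poincaré inequality for convex Lipschitz functions. With `s = c ε` and `t = C ε`, a second-moment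
bound at an infeasible `ε` gives `ε_K ≲ ε + σ`, while Chebyshev's inequality at a feasible `ε ≳ σ`
gives `ε_K ≳ ε`. This settles the regime of large `widthGapRate`.

In the other regime the upper bound combines `ε_K ≲ σ` with the trivial bound by the diameter, and
the lower bound is Le Cam's two-point argument (`exists_le_lseRisk_of_two_points`). -/

/-! ### Gaussian densities and shifts. -/

theorem pi_withDensity_prod {ι : Type*} [Fintype ι] {X : ι → Type*} [∀ i, MeasurableSpace (X i)]
    (ν : ∀ i, Measure (X i)) [∀ i, IsProbabilityMeasure (ν i)] (f : ∀ i, X i → ℝ≥0∞)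
    (hf : ∀ i, Measurable (f i)) [∀ i, SigmaFinite ((ν i).withDensity (f i))] :
    Measure.pi (fun i => (ν i).withDensity (f i)) =
      (Measure.pi ν).withDensity (fun x => ∏ i, f i (x i)) := by
  refine Measure.pi_eq fun s hs => ?_
  have hg : ∀ i, Measurable ((s i).indicator (f i)) := fun i => (hf i).indicator (hs i)
  have hind := iIndepFun_pi (μ := ν) (X := fun i => (s i).indicator (f i))
    (fun i => (hg i).aemeasurable)
  have h := lintegral_prod_eq_prod_lintegral_of_indepFun Finset.univ _ hind
    (fun i => (hg i).comp (measurable_pi_apply i))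
  rw [withDensity_apply _ (MeasurableSet.univ_pi hs),
    ← lintegral_indicator (MeasurableSet.univ_pi hs)]
  convert h using 1
  · refine lintegral_congr fun x => ?_
    by_cases hx : x ∈ Set.univ.pi s
    · rw [Set.indicator_of_mem hx]
      exact Finset.prod_congr rfl fun i _ => (Set.indicator_of_mem (hx i trivial) _).symm
    · rw [Set.indicator_of_notMem hx]
      simp only [Set.mem_pi, not_forall] at hx
      obtain ⟨i, _, hi⟩ := hx
      exact (Finset.prod_eq_zero (Finset.mem_univ i) (Set.indicator_of_notMem hi _)).symm
  · refine Finset.prod_congr rfl fun i _ => ?_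
    rw [withDensity_apply _ (hs i), ← lintegral_indicator (hs i)]
    exact ((measurePreserving_eval ν i).lintegral_comp (hg i)).symm

theorem gaussianReal_shift_density (m : ℝ) :
    gaussianReal m 1 = (gaussianReal 0 1).withDensity
      (fun x => ENNReal.ofReal (Real.exp (m * x - m ^ 2 / 2))) := by
  rw [gaussianReal_of_var_ne_zero _ one_ne_zero, gaussianReal_of_var_ne_zero _ one_ne_zero,
    ← withDensity_mul _ (measurable_gaussianPDF _ _) (by fun_prop)]
  congr 1
  ext x
  simp only [gaussianPDF, Pi.mul_apply]
  rw [← ENNReal.ofReal_mul (gaussianPDFReal_nonneg _ _ _)]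
  simp only [gaussianPDFReal, mul_assoc, ← Real.exp_add]
  congr 3
  simp only [NNReal.coe_one]
  ring_nf

/-- Lebesgue measure is the Gaussian reweighted by a nowhere vanishing density, coordinate by
coordinate. This transfers Rademacher's theorem to the Gaussian measure. -/
theorem stdGaussian_absolutelyContinuous {ι : Type*} [Fintype ι] :
    stdGaussian (EuclideanSpace ℝ ι) ≪ volume := by
  rw [← map_pi_eq_stdGaussian, ← (PiLp.volume_preserving_toLp ι).map_eq]
  refine Measure.AbsolutelyContinuous.map ?_ (by fun_prop)
  have h : (volume : Measure ℝ) =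
      (gaussianReal 0 1).withDensity (fun x => (gaussianPDF 0 1 x)⁻¹) := by
    rw [gaussianReal_of_var_ne_zero _ one_ne_zero, withDensity_inv_same (measurable_gaussianPDF _ _)
      (ae_of_all _ fun x => (gaussianPDF_pos _ one_ne_zero x).ne')
      (ae_of_all _ fun x => gaussianPDF_ne_top)]
  have hs : SigmaFinite ((gaussianReal 0 1).withDensity (fun x => (gaussianPDF 0 1 x)⁻¹)) := by
    rw [← h]; infer_instance
  rw [volume_pi, h, pi_withDensity_prod _ (fun _ x => (gaussianPDF 0 1 x)⁻¹)
    (fun _ => (measurable_gaussianPDF _ _).inv)]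
  refine withDensity_absolutelyContinuous' ?_ (ae_of_all _ fun x => ?_)
  · exact (Finset.measurable_fun_prod _ fun i _ =>
      ((measurable_gaussianPDF 0 1).comp (measurable_pi_apply i)).inv).aemeasurable
  · exact Finset.prod_ne_zero_iff.2 fun i _ => ENNReal.inv_ne_zero.2 gaussianPDF_ne_top

/-- The Cameron–Martin formula, obtained by multiplying the one-dimensional likelihood ratios. -/
theorem stdGaussian_map_add_const {ι : Type*} [Fintype ι] (θ : EuclideanSpace ℝ ι) :
    (stdGaussian (EuclideanSpace ℝ ι)).map (fun x => x + θ) =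
      (stdGaussian (EuclideanSpace ℝ ι)).withDensity
        (fun x => ENNReal.ofReal (Real.exp (inner ℝ x θ - ‖θ‖ ^ 2 / 2))) := by
  have h1 : (Measure.pi (fun _ : ι => gaussianReal 0 1)).map (fun x i => x i + θ i) =
      (Measure.pi (fun _ : ι => gaussianReal 0 1)).withDensity
        (fun x => ∏ i, ENNReal.ofReal (Real.exp (θ i * x i - θ i ^ 2 / 2))) := by
    have : ∀ i, SigmaFinite ((gaussianReal 0 1).withDensity
        (fun x => ENNReal.ofReal (Real.exp (θ i * x - θ i ^ 2 / 2)))) := fun i => by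
      rw [← gaussianReal_shift_density]; infer_instance
    have hm : ∀ i, (gaussianReal 0 1).map (fun x => x + θ i) = gaussianReal (θ i) 1 := fun i => by
      rw [gaussianReal_map_add_const, zero_add]
    have : ∀ i, SigmaFinite ((gaussianReal 0 1).map (fun x => x + θ i)) := fun i => by
      rw [hm]; infer_instance
    rw [← pi_withDensity_prod _ (fun i x => ENNReal.ofReal (Real.exp (θ i * x - θ i ^ 2 / 2)))
      (fun i => by fun_prop)]
    rw [Measure.pi_map_pi (f := fun i x => x + θ i) (fun i => by fun_prop)]
    simp_rw [hm, ← gaussianReal_shift_density]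
  rw [← map_pi_eq_stdGaussian, Measure.map_map (by fun_prop) (by fun_prop)]
  have h2 : (fun x : EuclideanSpace ℝ ι => x + θ) ∘ (WithLp.toLp 2) =
      (WithLp.toLp 2) ∘ (fun (x : ι → ℝ) i => x i + θ i) := by
    ext; simp
  rw [h2, ← Measure.map_map (by fun_prop) (by fun_prop), h1]
  ext s hs
  rw [Measure.map_apply (by fun_prop) hs, withDensity_apply _ hs,
    withDensity_apply _ ((by fun_prop : Measurable (WithLp.toLp 2)) hs),
    setLIntegral_map hs (by fun_prop) (by fun_prop)]
  refine lintegral_congr fun x => ?_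
  rw [← ENNReal.ofReal_prod_of_nonneg (fun _ _ => by positivity), ← Real.exp_sum,
    Finset.sum_sub_distrib, ← Finset.sum_div, EuclideanSpace.real_norm_sq_eq]
  simp [PiLp.inner_apply]

/-- Cauchy–Schwarz applied to the indicator of `A` and the likelihood ratio, whose second moment is
`exp (‖θ‖ ^ 2)`. -/
theorem stdGaussian_shift_sq_le {ι : Type*} [Fintype ι] (θ : EuclideanSpace ℝ ι)
    {A : Set (EuclideanSpace ℝ ι)} (hA : MeasurableSet A) :
    (stdGaussian (EuclideanSpace ℝ ι) ((fun x => x + θ) ⁻¹' A)) ^ 2 ≤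
      stdGaussian (EuclideanSpace ℝ ι) A * ENNReal.ofReal (Real.exp (‖θ‖ ^ 2)) := by
  set γ := stdGaussian (EuclideanSpace ℝ ι)
  set ρ : EuclideanSpace ℝ ι → ℝ≥0∞ :=
    fun x => ENNReal.ofReal (Real.exp (inner ℝ x θ - ‖θ‖ ^ 2 / 2))
  have hρ : Measurable ρ := by fun_prop
  have h1 : γ ((fun x => x + θ) ⁻¹' A) = ∫⁻ x, A.indicator 1 x * ρ x ∂γ := by
    rw [← Measure.map_apply (by fun_prop) hA, stdGaussian_map_add_const, withDensity_apply _ hA,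
      ← lintegral_indicator hA]
    refine lintegral_congr fun x => ?_
    by_cases hx : x ∈ A <;> simp [hx, ρ]
  have h2 : ∫⁻ x, ρ x ^ (2 : ℝ) ∂γ = ENNReal.ofReal (Real.exp (‖θ‖ ^ 2)) := by
    -- The squared ratio for `θ` is a constant times the ratio for `2θ`, which has total mass one.
    have hone : ∫⁻ x, ENNReal.ofReal
        (Real.exp (inner ℝ x ((2 : ℝ) • θ) - ‖(2 : ℝ) • θ‖ ^ 2 / 2)) ∂γ = 1 := by
      have := congrArg (fun m => m Set.univ) (stdGaussian_map_add_const ((2 : ℝ) • θ))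
      simp only [withDensity_apply _ MeasurableSet.univ, Measure.restrict_univ] at this
      rw [← this, Measure.map_apply (by fun_prop) MeasurableSet.univ]
      simp
    have h3 : ∀ x, ρ x ^ (2 : ℝ) = ENNReal.ofReal (Real.exp (‖θ‖ ^ 2)) * ENNReal.ofReal
        (Real.exp (inner ℝ x ((2 : ℝ) • θ) - ‖(2 : ℝ) • θ‖ ^ 2 / 2)) := fun x => by
      rw [← ENNReal.ofReal_mul (by positivity), ENNReal.rpow_two, ← ENNReal.ofReal_pow (by positivity),
        ← Real.exp_add, ← Real.exp_nat_mul, inner_smul_right, norm_smul]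
      congr 2
      simp only [Real.norm_ofNat]
      push_cast; ring
    simp_rw [h3]
    rw [lintegral_const_mul _ (by fun_prop), hone, mul_one]
  have h4 := ENNReal.lintegral_mul_le_Lp_mul_Lq γ Real.HolderConjugate.two_two
    (f := A.indicator 1) (g := ρ) ((measurable_one.indicator hA).aemeasurable) hρ.aemeasurable
  have h5 : ∫⁻ x, (A.indicator (1 : EuclideanSpace ℝ ι → ℝ≥0∞) x) ^ (2 : ℝ) ∂γ = γ A := by
    rw [← lintegral_indicator_one hA]
    refine lintegral_congr fun x => ?_
    by_cases hx : x ∈ A <;> simp [hx]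
  rw [h2, h5] at h4
  simp only [Pi.mul_apply] at h4
  rw [← h1] at h4
  calc _ ≤ _ := pow_le_pow_left' h4 2
    _ = _ := by
      rw [mul_pow, ← ENNReal.rpow_two, ← ENNReal.rpow_two, ← ENNReal.rpow_mul, ← ENNReal.rpow_mul]
      norm_num

/-! ### A dimension-free Poincaré inequality by Gaussian rotations. -/

theorem ConvexOn.add_fderiv_le {E : Type*} [NormedAddCommGroup E] [NormedSpace ℝ E] {g : E → ℝ}
    (hg : ConvexOn ℝ Set.univ g) {x : E} (hx : DifferentiableAt ℝ g x) (y : E) :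
    g x + fderiv ℝ g x (y - x) ≤ g y := by
  have h1 : ConvexOn ℝ Set.univ (g ∘ AffineMap.lineMap (k := ℝ) x y) := by
    simpa using hg.comp_affineMap (AffineMap.lineMap (k := ℝ) x y)
  have h2 : HasDerivAt (g ∘ AffineMap.lineMap (k := ℝ) x y) (fderiv ℝ g x (y - x)) 0 := by
    refine HasFDerivAt.comp_hasDerivAt 0 ?_ AffineMap.hasDerivAt_lineMap
    simpa using hx.hasFDerivAt
  have h3 := h1.le_slope_of_hasDerivAt (Set.mem_univ 0) (Set.mem_univ 1) one_pos h2
  simp [slope_def_field] at h3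
  rw [map_sub]
  linarith

section Poincare

variable {E : Type*} [NormedAddCommGroup E] [InnerProductSpace ℝ E] [FiniteDimensional ℝ E]
  [MeasurableSpace E] [BorelSpace E]

theorem lintegral_sq_dual_stdGaussian (L : StrongDual ℝ E) :
    ∫⁻ x, ENNReal.ofReal (L x ^ 2) ∂(stdGaussian E) = ENNReal.ofReal (‖L‖ ^ 2) := by
  have hL : MemLp L 2 (stdGaussian E) := IsGaussian.memLp_dual _ L _ (by simp)
  rw [← variance_dual_stdGaussian, variance_of_integral_eq_zero hL.1.aemeasurable (by simp),
    ofReal_integral_eq_lintegral_ofReal hL.integrable_sq (ae_of_all _ fun x => sq_nonneg _)]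

/-- The mean squared decrease of `g` along a rotation of angle `θ` of two independent standard
Gaussian vectors. -/
noncomputable def rotationDecrease (g : E → ℝ) (θ : ℝ) : ℝ≥0∞ :=
  ∫⁻ p, ENNReal.ofReal (g p.1 - g (Real.cos θ • p.1 + Real.sin θ • p.2)) ^ 2
    ∂((stdGaussian E).prod (stdGaussian E))

/-- A rotation by `2θ` is two rotations by `θ`, and the rotated pair has the law of the original
one; then `(a + b)² ≤ 2a² + 2b²`. -/
theorem rotationDecrease_two_mul {g : E → ℝ} (hg : Continuous g) (θ : ℝ) :
    rotationDecrease g (2 * θ) ≤ 4 * rotationDecrease g θ := by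
  set γ := (stdGaussian E).prod (stdGaussian E)
  have hrot : γ.map (ContinuousLinearMap.rotation θ) = γ :=
    IsGaussian.map_rotation_eq_self (by simp) θ
  set f : E × E → ℝ≥0∞ :=
    fun p => ENNReal.ofReal (g p.1 - g (Real.cos θ • p.1 + Real.sin θ • p.2)) ^ 2
  have hf : Measurable f := by
    have : Measurable g := hg.measurable
    fun_prop
  have h1 : rotationDecrease g θ = ∫⁻ p, f (ContinuousLinearMap.rotation θ p) ∂γ := by
    rw [← lintegral_map hf (by fun_prop), hrot]
    rfl
  have h2 : rotationDecrease g θ = ∫⁻ p, f p ∂γ := rfl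
  calc rotationDecrease g (2 * θ)
      ≤ ∫⁻ p, (2 * f p + 2 * f (ContinuousLinearMap.rotation θ p)) ∂γ := by
        refine lintegral_mono fun p => ?_
        have e : Real.cos (2 * θ) • p.1 + Real.sin (2 * θ) • p.2 =
            Real.cos θ • (ContinuousLinearMap.rotation θ p).1 +
              Real.sin θ • (ContinuousLinearMap.rotation θ p).2 := by
          rw [ContinuousLinearMap.rotation_apply, Real.cos_two_mul', Real.sin_two_mul]
          module
        simp only [f]
        rw [← mul_add, e]
        have h3 : g p.1 - g (Real.cos θ • (ContinuousLinearMap.rotation θ p).1 +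
              Real.sin θ • (ContinuousLinearMap.rotation θ p).2) =
            (g p.1 - g (Real.cos θ • p.1 + Real.sin θ • p.2)) +
            (g (ContinuousLinearMap.rotation θ p).1 -
              g (Real.cos θ • (ContinuousLinearMap.rotation θ p).1 +
                Real.sin θ • (ContinuousLinearMap.rotation θ p).2)) := by
          rw [ContinuousLinearMap.rotation_apply]; ring
        rw [h3]
        refine (pow_le_pow_left' ENNReal.ofReal_add_le 2).trans ?_
        simpa [show (2 : ℝ) - 1 = 1 by norm_num] using
          ENNReal.rpow_add_le_mul_rpow_add_rpow _ _ (one_le_two (α := ℝ))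
    _ = 4 * rotationDecrease g θ := by
        rw [lintegral_add_left (by fun_prop), lintegral_const_mul _ hf,
          lintegral_const_mul _ (by fun_prop), ← h1, ← h2, ← add_mul]
        norm_num

/-- The gradient inequality at `x` bounds decreases, hence the positive part. The independent
direction `y` contributes `‖D‖² ≤ L²` in mean square; the dimension enters only through `D x`, whose
weight `(1 - cos θ)²` is of order `θ⁴`. -/
theorem rotationDecrease_le {g : E → ℝ} (hc : ConvexOn ℝ Set.univ g) {L : ℝ≥0}
    (hL : LipschitzWith L g) (hd : ∀ᵐ x ∂(stdGaussian E), DifferentiableAt ℝ g x) (θ : ℝ) :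
    rotationDecrease g θ ≤ ENNReal.ofReal
      (2 * L ^ 2 * θ ^ 2 * (1 + θ ^ 2 / 4 * ∫ x, ‖x‖ ^ 2 ∂(stdGaussian E))) := by
  have hint : Integrable (fun x => ‖x‖ ^ 2) (stdGaussian E) :=
    (IsGaussian.memLp_two_id (μ := stdGaussian E)).integrable_norm_pow (by simp)
  have hmeas : Measurable (fun p : E × E =>
      ENNReal.ofReal (g p.1 - g (Real.cos θ • p.1 + Real.sin θ • p.2)) ^ 2) := by
    have : Measurable g := hL.continuous.measurable
    fun_prop
  have hcos : (1 - Real.cos θ) ^ 2 ≤ θ ^ 4 / 4 := by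
    have h1 := Real.one_sub_sq_div_two_le_cos (x := θ)
    have h2 := Real.cos_le_one θ
    nlinarith
  have hsin : Real.sin θ ^ 2 ≤ θ ^ 2 := by
    rw [sq_le_sq]; exact Real.abs_sin_le_abs
  rw [rotationDecrease, lintegral_prod _ hmeas.aemeasurable]
  calc _ ≤ ∫⁻ x, ENNReal.ofReal (2 * L ^ 2 * θ ^ 2 * (1 + θ ^ 2 / 4 * ‖x‖ ^ 2))
          ∂(stdGaussian E) := ?_
    _ = _ := ?_
  · refine lintegral_mono_ae ?_
    filter_upwards [hd] with x hx
    set D := fderiv ℝ g x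
    have hD : ‖D‖ ≤ L := norm_fderiv_le_of_lipschitz ℝ hL
    have hDx : |D x| ≤ L * ‖x‖ := (D.le_opNorm x).trans (by gcongr)
    calc ∫⁻ y, ENNReal.ofReal (g x - g (Real.cos θ • x + Real.sin θ • y)) ^ 2 ∂(stdGaussian E)
        ≤ ∫⁻ y, (ENNReal.ofReal (2 * (1 - Real.cos θ) ^ 2 * D x ^ 2) +
            ENNReal.ofReal (2 * Real.sin θ ^ 2) * ENNReal.ofReal (D y ^ 2)) ∂(stdGaussian E) := by
          refine lintegral_mono fun y => ?_
          have h1 := hc.add_fderiv_le hx (Real.cos θ • x + Real.sin θ • y)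
          have h2 : fderiv ℝ g x (Real.cos θ • x + Real.sin θ • y - x) =
              Real.sin θ * D y - (1 - Real.cos θ) * D x := by
            simp only [map_sub, map_add, map_smul, smul_eq_mul, D]; ring
          rw [h2] at h1
          have h3 : ENNReal.ofReal (g x - g (Real.cos θ • x + Real.sin θ • y)) ≤
              ENNReal.ofReal |(1 - Real.cos θ) * D x - Real.sin θ * D y| :=
            ENNReal.ofReal_le_ofReal ((by linarith :
              _ ≤ (1 - Real.cos θ) * D x - Real.sin θ * D y).trans (le_abs_self _))
          refine (pow_le_pow_left' h3 2).trans ?_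
          rw [← ENNReal.ofReal_pow (abs_nonneg _), sq_abs, ← ENNReal.ofReal_mul (by positivity),
            ← ENNReal.ofReal_add (by positivity) (by positivity)]
          refine ENNReal.ofReal_le_ofReal ?_
          nlinarith [sq_nonneg ((1 - Real.cos θ) * D x + Real.sin θ * D y)]
      _ = ENNReal.ofReal (2 * (1 - Real.cos θ) ^ 2 * D x ^ 2 + 2 * Real.sin θ ^ 2 * ‖D‖ ^ 2) := by
          rw [lintegral_add_left (by fun_prop), lintegral_const_mul _ (by fun_prop),
            lintegral_sq_dual_stdGaussian, lintegral_const, measure_univ, mul_one,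
            ← ENNReal.ofReal_mul (by positivity),
            ← ENNReal.ofReal_add (by positivity) (by positivity)]
      _ ≤ _ := by
          refine ENNReal.ofReal_le_ofReal ?_
          have h1 : D x ^ 2 ≤ L ^ 2 * ‖x‖ ^ 2 := by
            rw [← mul_pow, ← sq_abs]; gcongr
          calc _ ≤ 2 * (θ ^ 4 / 4) * (L ^ 2 * ‖x‖ ^ 2) + 2 * θ ^ 2 * (L : ℝ) ^ 2 := by gcongr
            _ = _ := by ring
  · rw [← ofReal_integral_eq_lintegral_ofReal]
    · congr 1
      rw [integral_const_mul, integral_add (integrable_const _) (hint.const_mul _),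
        integral_const_mul]
      simp
    · exact ((integrable_const _).add (hint.const_mul _)).const_mul _
    · exact ae_of_all _ fun x => by positivity

/-- Halving the angle `k` times costs `4 ^ k`, which the factor `θ²` absorbs exactly, and the
dimensional term vanishes as `k → ∞`. The limit is `2 L² (π / 2)² ≤ 5 L²`. -/
theorem rotationDecrease_pi_div_two_le {g : E → ℝ} (hc : ConvexOn ℝ Set.univ g) {L : ℝ≥0}
    (hL : LipschitzWith L g) (hd : ∀ᵐ x ∂(stdGaussian E), DifferentiableAt ℝ g x) :
    rotationDecrease g (Real.pi / 2) ≤ ENNReal.ofReal (5 * L ^ 2) := by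
  set M := ∫ x, ‖x‖ ^ 2 ∂(stdGaussian E)
  set u : ℕ → ℝ := fun k => Real.pi / 2 / 2 ^ k
  have h1 : ∀ k : ℕ, rotationDecrease g (Real.pi / 2) ≤ 4 ^ k * rotationDecrease g (u k) := by
    intro k
    induction k with
    | zero => simp [u]
    | succ k ih =>
      refine ih.trans ?_
      have : u k = 2 * u (k + 1) := by simp only [u, pow_succ]; field_simp
      rw [this, pow_succ, mul_assoc]
      gcongr
      exact rotationDecrease_two_mul hL.continuous _
  have h2 : ∀ k : ℕ, rotationDecrease g (Real.pi / 2) ≤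
      ENNReal.ofReal (2 * L ^ 2 * (Real.pi / 2) ^ 2 * (1 + u k ^ 2 / 4 * M)) := by
    intro k
    refine (h1 k).trans ((mul_le_mul_right (rotationDecrease_le hc hL hd _) _).trans_eq ?_)
    have : (4 : ℝ≥0∞) ^ k = ENNReal.ofReal (4 ^ k) := by
      rw [ENNReal.ofReal_pow (by norm_num)]; norm_num
    rw [this, ← ENNReal.ofReal_mul (by positivity)]
    congr 1
    have h4 : (u k) ^ 2 * 4 ^ k = (Real.pi / 2) ^ 2 := by
      simp only [u]
      rw [div_pow, ← pow_mul, mul_comm k 2, pow_mul]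
      norm_num
    rw [← h4]; ring
  have hu : Filter.Tendsto u Filter.atTop (nhds 0) := by
    have := (tendsto_pow_atTop_nhds_zero_of_lt_one (r := (1 / 2 : ℝ)) (by norm_num)
      (by norm_num)).const_mul (Real.pi / 2)
    rw [mul_zero] at this
    refine this.congr fun k => ?_
    simp only [u]; rw [div_pow, one_pow]; ring
  have h3 : Filter.Tendsto (fun k => 2 * (L : ℝ) ^ 2 * (Real.pi / 2) ^ 2 * (1 + u k ^ 2 / 4 * M))
      Filter.atTop (nhds (2 * (L : ℝ) ^ 2 * (Real.pi / 2) ^ 2)) := by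
    have := ((((hu.pow 2).div_const 4).mul_const M).const_add 1).const_mul
      (2 * (L : ℝ) ^ 2 * (Real.pi / 2) ^ 2)
    simpa using this
  have h4 := ge_of_tendsto' (ENNReal.tendsto_ofReal h3) h2
  refine h4.trans (ENNReal.ofReal_le_ofReal ?_)
  have hp : Real.pi ^ 2 ≤ 10 := by nlinarith [Real.pi_lt_d2, Real.pi_pos]
  nlinarith [sq_nonneg (L : ℝ)]

end Poincare

theorem LipschitzWith.memLp_two_stdGaussian {ι : Type*} [Fintype ι] {g : EuclideanSpace ℝ ι → ℝ}
    {L : ℝ≥0} (hL : LipschitzWith L g) : MemLp g 2 (stdGaussian (EuclideanSpace ℝ ι)) := by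
  have h1 : MemLp (fun x : EuclideanSpace ℝ ι => |g 0| + L * ‖x‖) 2
      (stdGaussian (EuclideanSpace ℝ ι)) :=
    (memLp_const (|g 0|)).add ((IsGaussian.memLp_two_id
      (μ := stdGaussian (EuclideanSpace ℝ ι))).norm.const_mul (L : ℝ))
  refine h1.mono' hL.continuous.aestronglyMeasurable (ae_of_all _ fun x => ?_)
  have := hL.dist_le_mul x 0
  rw [dist_zero_right, Real.dist_eq] at this
  rw [Real.norm_eq_abs]
  have h2 := abs_sub_abs_le_abs_sub (g x) (g 0)
  linarith

/-- A Poincaré inequality: a convex `L`-Lipschitz function of a standard Gaussian vector has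
variance at most `5 L²`. -/
theorem ConvexOn.variance_stdGaussian_le {ι : Type*} [Fintype ι] {g : EuclideanSpace ℝ ι → ℝ}
    (hc : ConvexOn ℝ Set.univ g) {L : ℝ≥0} (hL : LipschitzWith L g) :
    Var[g; stdGaussian (EuclideanSpace ℝ ι)] ≤ 5 * L ^ 2 := by
  set γ := stdGaussian (EuclideanSpace ℝ ι)
  have hm : MemLp g 2 γ := hL.memLp_two_stdGaussian
  have hd : ∀ᵐ x ∂γ, DifferentiableAt ℝ g x :=
    stdGaussian_absolutelyContinuous.ae_le hL.ae_differentiableAt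
  have hgm : Measurable g := hL.continuous.measurable
  -- Rotation by `π / 2` replaces `p.1` by the independent copy `p.2`.
  have h1 : ∫⁻ p, ENNReal.ofReal (g p.1 - g p.2) ^ 2 ∂(γ.prod γ) ≤ ENNReal.ofReal (5 * L ^ 2) := by
    simpa [rotationDecrease] using rotationDecrease_pi_div_two_le hc hL hd
  have h2 : ∫⁻ p, ENNReal.ofReal (g p.2 - g p.1) ^ 2 ∂(γ.prod γ) ≤ ENNReal.ofReal (5 * L ^ 2) := by
    rw [← lintegral_prod_swap]
    exact h1
  have h3 : ∫⁻ p, ENNReal.ofReal ((g p.1 - g p.2) ^ 2) ∂(γ.prod γ) ≤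
      ENNReal.ofReal (10 * L ^ 2) := by
    calc _ ≤ ∫⁻ p, (ENNReal.ofReal (g p.1 - g p.2) ^ 2 + ENNReal.ofReal (g p.2 - g p.1) ^ 2)
          ∂(γ.prod γ) := by
          refine lintegral_mono fun p => ?_
          rcases le_total (g p.1) (g p.2) with h | h
          · refine le_add_left ?_
            rw [← ENNReal.ofReal_pow (by linarith)]
            exact ENNReal.ofReal_le_ofReal (by nlinarith)
          · refine le_add_right ?_
            rw [← ENNReal.ofReal_pow (by linarith)]
      _ ≤ _ := by
          rw [lintegral_add_left (by fun_prop)]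
          refine (add_le_add h1 h2).trans_eq ?_
          rw [← ENNReal.ofReal_add (by positivity) (by positivity)]
          ring_nf
  -- The variance of `g p.1 - g p.2` is twice that of `g`, so `10 L²` becomes `5 L²`.
  have h4 := variance_add_prod hm hm.neg
  have hm2 : MemLp (fun p : EuclideanSpace ℝ ι × EuclideanSpace ℝ ι => g p.1 - g p.2) 2
      (γ.prod γ) := (hm.comp_fst γ).sub (hm.comp_snd γ)
  have h5 : Var[fun p : EuclideanSpace ℝ ι × EuclideanSpace ℝ ι => g p.1 - g p.2; γ.prod γ]
      ≤ 10 * L ^ 2 := by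
    refine (variance_le_expectation_sq hm2.1).trans ?_
    rw [← ENNReal.ofReal_le_ofReal_iff (by positivity)]
    refine le_trans (le_of_eq ?_) h3
    exact ofReal_integral_eq_lintegral_ofReal hm2.integrable_sq (ae_of_all _ fun _ => sq_nonneg _)
  have h6 : Var[-g; γ] = Var[g; γ] := variance_neg
  simp only [Pi.neg_apply, ← sub_eq_add_neg] at h4
  rw [h4, h6] at h5
  linarith

/-! ### Support functions and concavity in the radius. -/

section SupportFunction

variable {E : Type*} [NormedAddCommGroup E] [InnerProductSpace ℝ E]

/-- The support function `x ↦ sup_{t ∈ T} ⟨x, t⟩` of a set `T`. -/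
noncomputable def supportFn (T : Set E) (x : E) : ℝ :=
  sSup ((fun t => inner ℝ x t) '' T)

theorem bddAbove_inner_image {T : Set E} (hT : Bornology.IsBounded T) (x : E) :
    BddAbove ((fun t => inner ℝ x t) '' T) := by
  obtain ⟨R, hR⟩ := hT.exists_norm_le
  refine ⟨‖x‖ * R, ?_⟩
  rintro _ ⟨t, ht, rfl⟩
  exact (real_inner_le_norm x t).trans (by gcongr; exact hR t ht)

theorem inner_le_supportFn {T : Set E} (hT : Bornology.IsBounded T) (x : E) {t : E} (ht : t ∈ T) :
    inner ℝ x t ≤ supportFn T x :=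
  le_csSup (bddAbove_inner_image hT x) ⟨t, ht, rfl⟩

theorem supportFn_le {T : Set E} (hne : T.Nonempty) {x : E} {b : ℝ}
    (h : ∀ t ∈ T, inner ℝ x t ≤ b) : supportFn T x ≤ b := by
  refine csSup_le (hne.image _) ?_
  rintro _ ⟨t, ht, rfl⟩
  exact h t ht

theorem convexOn_supportFn_sub_inner {T : Set E} (hne : T.Nonempty) (hT : Bornology.IsBounded T)
    (μ : E) : ConvexOn ℝ Set.univ (fun x => supportFn T x - inner ℝ x μ) := by
  refine ⟨convex_univ, fun x _ y _ a b ha hb _ => ?_⟩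
  have h : supportFn T (a • x + b • y) ≤ a * supportFn T x + b * supportFn T y := by
    refine supportFn_le hne fun t ht => ?_
    rw [inner_add_left, real_inner_smul_left, real_inner_smul_left]
    gcongr
    exacts [inner_le_supportFn hT x ht, inner_le_supportFn hT y ht]
  simp only [smul_eq_mul, inner_add_left, real_inner_smul_left]
  linarith

theorem lipschitzWith_supportFn_sub_inner {T : Set E} (hne : T.Nonempty) {μ : E} {L : ℝ≥0}
    (hT : T ⊆ Metric.closedBall μ L) :
    LipschitzWith L (fun x => supportFn T x - inner ℝ x μ) := by
  have hb : Bornology.IsBounded T := Metric.isBounded_closedBall.subset hT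
  refine LipschitzWith.of_le_add_mul L fun x y => ?_
  have h : supportFn T x ≤ supportFn T y + inner ℝ (x - y) μ + L * dist x y := by
    refine supportFn_le hne fun t ht => ?_
    have h1 := inner_le_supportFn hb y ht
    have h2 : inner ℝ (x - y) (t - μ) ≤ dist x y * L :=
      (real_inner_le_norm _ _).trans (by
        rw [← dist_eq_norm, ← dist_eq_norm]
        gcongr
        exact hT ht)
    simp only [inner_sub_left, inner_sub_right] at h2 ⊢
    linarith
  simp only [inner_sub_left] at h
  linarith

/-- A convex combination of points of `K` in the balls of radii `t` and `r` lies in `K` and in the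
ball of the averaged radius `s`. -/
theorem supportFn_closedBall_inter_concave {K : Set E} (hK : Convex ℝ K) {μ : E} (hμ : μ ∈ K)
    (x : E) {r s t : ℝ} (hr : 0 ≤ r) (hrs : r ≤ s) (hst : s ≤ t) (hrt : r < t) :
    (s - r) * supportFn (Metric.closedBall μ t ∩ K) x +
        (t - s) * supportFn (Metric.closedBall μ r ∩ K) x ≤
      (t - r) * supportFn (Metric.closedBall μ s ∩ K) x := by
  have hne : ∀ {u : ℝ}, 0 ≤ u → (Metric.closedBall μ u ∩ K).Nonempty := fun hu =>
    ⟨μ, Metric.mem_closedBall_self hu, hμ⟩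
  have hb : ∀ u : ℝ, Bornology.IsBounded (Metric.closedBall μ u ∩ K) := fun u =>
    Metric.isBounded_closedBall.subset Set.inter_subset_left
  have hpos : 0 < t - r := by linarith
  have key : ∀ p ∈ Metric.closedBall μ t ∩ K, ∀ q ∈ Metric.closedBall μ r ∩ K,
      (s - r) * inner ℝ x p + (t - s) * inner ℝ x q ≤
        (t - r) * supportFn (Metric.closedBall μ s ∩ K) x := by
    intro p hp q hq
    set a := (s - r) / (t - r) with ha
    set b := (t - s) / (t - r) with hb'
    have ha0 : 0 ≤ a := div_nonneg (by linarith) hpos.le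
    have hb0 : 0 ≤ b := div_nonneg (by linarith) hpos.le
    have hab : a + b = 1 := by rw [ha, hb', ← add_div, div_eq_one_iff_eq hpos.ne']; ring
    have hmem : a • p + b • q ∈ Metric.closedBall μ s ∩ K := by
      refine ⟨?_, hK hp.2 hq.2 ha0 hb0 hab⟩
      have hp1 := hp.1
      have hq1 := hq.1
      rw [mem_closedBall_iff_norm] at hp1 hq1 ⊢
      have e : a • p + b • q - μ = a • (p - μ) + b • (q - μ) := by
        have hμab : μ = a • μ + b • μ := by rw [← add_smul, hab, one_smul]
        nth_rw 1 [hμab]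
        module
      rw [e]
      calc _ ≤ a * t + b * r := by
            refine (norm_add_le _ _).trans ?_
            rw [norm_smul, norm_smul, Real.norm_of_nonneg ha0, Real.norm_of_nonneg hb0]
            gcongr
        _ = s := by rw [ha, hb']; field_simp; ring
    have h := inner_le_supportFn (hb s) x hmem
    rw [inner_add_right, real_inner_smul_right, real_inner_smul_right] at h
    calc _ = (t - r) * (a * inner ℝ x p + b * inner ℝ x q) := by rw [ha, hb']; field_simp
      _ ≤ _ := by gcongr
  have h1 : ∀ q ∈ Metric.closedBall μ r ∩ K,
      (s - r) * supportFn (Metric.closedBall μ t ∩ K) x + (t - s) * inner ℝ x q ≤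
        (t - r) * supportFn (Metric.closedBall μ s ∩ K) x := by
    intro q hq
    -- Passing to the supremum over `p` divides by `s - r`, so `r = s` is treated apart.
    rcases hrs.eq_or_lt with rfl | h
    · have := key μ (by exact ⟨Metric.mem_closedBall_self (by linarith), hμ⟩) q hq
      simpa using this
    · have : supportFn (Metric.closedBall μ t ∩ K) x ≤
          ((t - r) * supportFn (Metric.closedBall μ s ∩ K) x - (t - s) * inner ℝ x q) / (s - r) :=
        supportFn_le (hne (by linarith)) fun p hp => by
          rw [le_div_iff₀ (by linarith)]
          linarith [key p hp q hq]
      rw [le_div_iff₀ (by linarith)] at this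
      linarith
  rcases hst.eq_or_lt with rfl | h
  · simp
  · have : supportFn (Metric.closedBall μ r ∩ K) x ≤
        ((t - r) * supportFn (Metric.closedBall μ s ∩ K) x -
          (s - r) * supportFn (Metric.closedBall μ t ∩ K) x) / (t - s) :=
      supportFn_le (hne hr) fun q hq => by
        rw [le_div_iff₀ (by linarith)]
        linarith [h1 q hq]
    rw [le_div_iff₀ (by linarith)] at this
    linarith

end SupportFunction

/-! ### Deterministic bounds on the least squares error. -/

section LeastSquares

variable {n : ℕ} {K : Set (EuclideanSpace ℝ (Fin n))}

theorem IsLeastSquares.inner_le_zero (hcv : Convex ℝ K) {y ν : EuclideanSpace ℝ (Fin n)}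
    (h : IsLeastSquares K y ν) {t : EuclideanSpace ℝ (Fin n)} (ht : t ∈ K) :
    inner ℝ (y - ν) (t - ν) ≤ 0 := by
  refine (norm_eq_iInf_iff_real_inner_le_zero hcv h.1).1 ?_ t ht
  have : Nonempty K := ⟨⟨ν, h.1⟩⟩
  refine le_antisymm (le_ciInf fun w => ?_) (ciInf_le ⟨0, ?_⟩ (⟨ν, h.1⟩ : K))
  · exact le_of_sq_le_sq (h.2 w w.2) (norm_nonneg _)
  · rintro _ ⟨w, rfl⟩
    exact norm_nonneg _

/-- Adding the variational inequalities at the two projections gives firm nonexpansiveness. -/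
theorem lipschitzWith_lse (hne : K.Nonempty) (hcl : IsClosed K) (hcv : Convex ℝ K) :
    LipschitzWith 1 (lse K) := by
  refine LipschitzWith.of_dist_le_mul fun y z => ?_
  have hy := lse_spec hne hcl y
  have hz := lse_spec hne hcl z
  have h1 := hy.inner_le_zero hcv hz.1
  have h2 := hz.inner_le_zero hcv hy.1
  set p := lse K y
  set q := lse K z
  have h3 : ‖p - q‖ ^ 2 ≤ inner ℝ (y - z) (p - q) := by
    rw [← real_inner_self_eq_norm_sq]
    have e1 : inner ℝ (y - p) (q - p) = - inner ℝ (y - p) (p - q) := by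
      rw [← inner_neg_right, neg_sub]
    have e2 : inner ℝ (y - z) (p - q) - inner ℝ (p - q) (p - q) =
        inner ℝ (y - p) (p - q) - inner ℝ (z - q) (p - q) := by
      rw [← inner_sub_left, ← inner_sub_left]; congr 1; abel
    linarith
  have h4 := h3.trans (real_inner_le_norm _ _)
  rw [NNReal.coe_one, one_mul, dist_eq_norm, dist_eq_norm]
  by_contra! h5
  nlinarith [norm_nonneg (y - z), norm_nonneg (p - q)]

/-- Comparing the minimizer with points of the `s`-ball shows that the slope of `F` over `[s, r]` is
at least `(r + s) / (2σ)`; by concavity the slope over `[s, t]` is no smaller. -/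
theorem lse_error_le_of_ge (hcl : IsClosed K) (hcv : Convex ℝ K)
    {μ : EuclideanSpace ℝ (Fin n)} (hμ : μ ∈ K) {σ : ℝ} (hσ : 0 < σ)
    (x : EuclideanSpace ℝ (Fin n)) {s t : ℝ} (hs : 0 ≤ s) (hst : s < t)
    (hr : t ≤ ‖lse K (μ + σ • x) - μ‖) :
    ‖lse K (μ + σ • x) - μ‖ ≤ 2 * σ / (t - s) *
      (supportFn (Metric.closedBall μ t ∩ K) x - supportFn (Metric.closedBall μ s ∩ K) x) := by
  have hls := lse_spec ⟨μ, hμ⟩ hcl (μ + σ • x)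
  set ν := lse K (μ + σ • x)
  set r := ‖ν - μ‖ with hrdef
  have hb : ∀ u : ℝ, Bornology.IsBounded (Metric.closedBall μ u ∩ K) := fun u =>
    Metric.isBounded_closedBall.subset Set.inter_subset_left
  have hnorm : ∀ w, ‖μ + σ • x - w‖ ^ 2 =
      σ ^ 2 * ‖x‖ ^ 2 - 2 * σ * (inner ℝ x w - inner ℝ x μ) + ‖w - μ‖ ^ 2 := fun w => by
    rw [show μ + σ • x - w = σ • x - (w - μ) by abel, norm_sub_sq_real, norm_smul,
      real_inner_smul_left, inner_sub_right, mul_pow, Real.norm_eq_abs, sq_abs]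
    ring
  have hνF : inner ℝ x ν ≤ supportFn (Metric.closedBall μ r ∩ K) x :=
    have hmem : ν ∈ Metric.closedBall μ r ∩ K := ⟨mem_closedBall_iff_norm.2 le_rfl, hls.1⟩
    inner_le_supportFn (hb r) x hmem
  have h1 : supportFn (Metric.closedBall μ s ∩ K) x ≤
      supportFn (Metric.closedBall μ r ∩ K) x - (r ^ 2 - s ^ 2) / (2 * σ) := by
    have hne : (Metric.closedBall μ s ∩ K).Nonempty := ⟨μ, Metric.mem_closedBall_self hs, hμ⟩
    refine supportFn_le hne fun w hw => ?_
    have h2 := hls.2 w hw.2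
    have h3 : ‖w - μ‖ ^ 2 ≤ s ^ 2 := by
      have := mem_closedBall_iff_norm.1 hw.1
      gcongr
    rw [hnorm, hnorm] at h2
    rw [le_sub_iff_add_le, ← le_sub_iff_add_le', div_le_iff₀ (by positivity)]
    nlinarith
  have h2 := supportFn_closedBall_inter_concave hcv hμ x hs hst.le hr (hst.trans_le hr)
  set D := supportFn (Metric.closedBall μ t ∩ K) x - supportFn (Metric.closedBall μ s ∩ K) x
    with hD
  rw [le_sub_iff_add_le, ← le_sub_iff_add_le', div_le_iff₀ (by positivity)] at h1
  have hts : 0 < t - s := by linarith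
  have hrs : 0 < r - s := by linarith
  rw [div_mul_eq_mul_div, le_div_iff₀ hts]
  have h3 : (r - s) * ((r + s) * (t - s)) ≤ (r - s) * (2 * σ * D) := by
    have h4 : (supportFn (Metric.closedBall μ r ∩ K) x -
        supportFn (Metric.closedBall μ s ∩ K) x) * (t - s) ≤ (r - s) * D := by
      rw [hD]; linarith
    calc _ = (r ^ 2 - s ^ 2) * (t - s) := by ring
      _ ≤ _ := mul_le_mul_of_nonneg_right h1 hts.le
      _ = 2 * σ * ((supportFn (Metric.closedBall μ r ∩ K) x -
        supportFn (Metric.closedBall μ s ∩ K) x) * (t - s)) := by ring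
      _ ≤ 2 * σ * ((r - s) * D) := by gcongr
      _ = _ := by ring
  have h5 := le_of_mul_le_mul_left h3 hrs
  nlinarith

/-- The variational inequality bounds the slope of `F` over `[r, s]` by `r / σ`; by concavity the
slope over `[s, t]` is no larger. -/
theorem supportFn_gap_le_of_lse_error_lt (hcl : IsClosed K) (hcv : Convex ℝ K)
    {μ : EuclideanSpace ℝ (Fin n)} (hμ : μ ∈ K) {σ : ℝ} (hσ : 0 < σ)
    (x : EuclideanSpace ℝ (Fin n)) {s t : ℝ} (hst : s ≤ t)
    (hr : ‖lse K (μ + σ • x) - μ‖ < s) :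
    supportFn (Metric.closedBall μ t ∩ K) x - supportFn (Metric.closedBall μ s ∩ K) x ≤
      (t - s) * ‖lse K (μ + σ • x) - μ‖ / σ := by
  have hls := lse_spec ⟨μ, hμ⟩ hcl (μ + σ • x)
  set ν := lse K (μ + σ • x)
  set r := ‖ν - μ‖ with hrdef
  have hr0 : 0 ≤ r := norm_nonneg _
  have hb : ∀ u : ℝ, Bornology.IsBounded (Metric.closedBall μ u ∩ K) := fun u =>
    Metric.isBounded_closedBall.subset Set.inter_subset_left
  have hνF : inner ℝ x ν ≤ supportFn (Metric.closedBall μ r ∩ K) x :=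
    have hmem : ν ∈ Metric.closedBall μ r ∩ K := ⟨mem_closedBall_iff_norm.2 le_rfl, hls.1⟩
    inner_le_supportFn (hb r) x hmem
  have h1 : supportFn (Metric.closedBall μ s ∩ K) x ≤
      supportFn (Metric.closedBall μ r ∩ K) x + r * (s - r) / σ := by
    have hne : (Metric.closedBall μ s ∩ K).Nonempty :=
      ⟨μ, Metric.mem_closedBall_self (by linarith), hμ⟩
    refine supportFn_le hne fun w hw => ?_
    have h2 := hls.inner_le_zero hcv hw.2
    have h3 : inner ℝ (ν - μ) (w - μ) ≤ r * s :=
      (real_inner_le_norm _ _).trans (by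
        gcongr
        exact mem_closedBall_iff_norm.1 hw.1)
    have h4 : inner ℝ (μ + σ • x - ν) (w - ν) =
        σ * (inner ℝ x w - inner ℝ x ν) - inner ℝ (ν - μ) (w - μ) + r ^ 2 := by
      rw [show μ + σ • x - ν = σ • x - (ν - μ) by abel, inner_sub_left, real_inner_smul_left,
        inner_sub_right x, show w - ν = (w - μ) - (ν - μ) by abel, inner_sub_right (ν - μ),
        real_inner_self_eq_norm_sq]
      ring
    have h5 : inner ℝ x w - inner ℝ x ν ≤ r * (s - r) / σ := by
      rw [le_div_iff₀ hσ]; nlinarith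
    linarith
  have h2 := supportFn_closedBall_inter_concave hcv hμ x hr0 hr.le hst (by linarith)
  have hsr : 0 < s - r := by linarith
  refine le_of_mul_le_mul_left (a := s - r) ?_ hsr
  calc (s - r) * (supportFn (Metric.closedBall μ t ∩ K) x -
        supportFn (Metric.closedBall μ s ∩ K) x)
      ≤ (t - s) * (supportFn (Metric.closedBall μ s ∩ K) x -
        supportFn (Metric.closedBall μ r ∩ K) x) := by linarith
    _ ≤ (t - s) * (r * (s - r) / σ) := by
        have : 0 ≤ t - s := by linarith
        gcongr
        linarith
    _ = _ := by ring

end LeastSquares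

/-! ### Moments of the gap and risk bounds at one mean. -/

section Gap

variable {n : ℕ} {K : Set (EuclideanSpace ℝ (Fin n))}

/-- The increment, from radius `s` to radius `t`, of the support function of `B(μ, ·) ∩ K`. -/
noncomputable def supportGap (K : Set (EuclideanSpace ℝ (Fin n))) (μ : EuclideanSpace ℝ (Fin n))
    (s t : ℝ) (x : EuclideanSpace ℝ (Fin n)) : ℝ :=
  supportFn (Metric.closedBall μ t ∩ K) x - supportFn (Metric.closedBall μ s ∩ K) x

theorem supportGap_nonneg {μ : EuclideanSpace ℝ (Fin n)} (hμ : μ ∈ K) {s t : ℝ} (hs : 0 ≤ s)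
    (hst : s ≤ t) (x : EuclideanSpace ℝ (Fin n)) : 0 ≤ supportGap K μ s t x := by
  have hne : (Metric.closedBall μ s ∩ K).Nonempty := ⟨μ, Metric.mem_closedBall_self hs, hμ⟩
  have hb : Bornology.IsBounded (Metric.closedBall μ t ∩ K) :=
    Metric.isBounded_closedBall.subset Set.inter_subset_left
  exact sub_nonneg.2 (supportFn_le hne fun w hw =>
    inner_le_supportFn hb x ⟨Metric.closedBall_subset_closedBall hst hw.1, hw.2⟩)

variable {μ : EuclideanSpace ℝ (Fin n)} {s t : ℝ}

/-- Subtracting `⟨x, μ⟩` recentres the set, so the Lipschitz constant is the radius, whatever `‖μ‖`;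
the correction cancels in the gap. -/
theorem localized_supportFn_convex_lipschitz (hμ : μ ∈ K) (hs : 0 ≤ s) :
    ConvexOn ℝ Set.univ (fun x => supportFn (Metric.closedBall μ s ∩ K) x - inner ℝ x μ) ∧
    LipschitzWith s.toNNReal
      (fun x => supportFn (Metric.closedBall μ s ∩ K) x - inner ℝ x μ) := by
  have hne : (Metric.closedBall μ s ∩ K).Nonempty := ⟨μ, Metric.mem_closedBall_self hs, hμ⟩
  refine ⟨convexOn_supportFn_sub_inner hne
    (Metric.isBounded_closedBall.subset Set.inter_subset_left) μ,
    lipschitzWith_supportFn_sub_inner hne ?_⟩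
  rw [Real.coe_toNNReal _ hs]
  exact Set.inter_subset_left

theorem supportGap_eq : supportGap K μ s t =
    (fun x => supportFn (Metric.closedBall μ t ∩ K) x - inner ℝ x μ) -
      (fun x => supportFn (Metric.closedBall μ s ∩ K) x - inner ℝ x μ) := by
  ext x
  simp [supportGap]

theorem continuous_supportGap (hμ : μ ∈ K) (hs : 0 ≤ s) (ht : 0 ≤ t) :
    Continuous (supportGap K μ s t) := by
  rw [supportGap_eq]
  exact (localized_supportFn_convex_lipschitz hμ ht).2.continuous.sub
    (localized_supportFn_convex_lipschitz hμ hs).2.continuous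

theorem memLp_supportGap (hμ : μ ∈ K) (hs : 0 ≤ s) (ht : 0 ≤ t) :
    MemLp (supportGap K μ s t) 2 (stdGaussian (EuclideanSpace ℝ (Fin n))) := by
  rw [supportGap_eq]
  exact (localized_supportFn_convex_lipschitz hμ ht).2.memLp_two_stdGaussian.sub
    (localized_supportFn_convex_lipschitz hμ hs).2.memLp_two_stdGaussian

theorem integrable_localized_supportFn (hμ : μ ∈ K) (hs : 0 ≤ s) :
    Integrable (supportFn (Metric.closedBall μ s ∩ K))
      (stdGaussian (EuclideanSpace ℝ (Fin n))) := by
  have h1 := (localized_supportFn_convex_lipschitz hμ hs).2.memLp_two_stdGaussian.integrable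
    one_le_two
  have h2 : Integrable (fun x => inner ℝ x μ) (stdGaussian (EuclideanSpace ℝ (Fin n))) :=
    (IsGaussian.integrable_fun_id (μ := stdGaussian (EuclideanSpace ℝ (Fin n)))).inner_const μ
  refine (h1.add h2).congr (ae_of_all _ fun x => ?_)
  simp

theorem integral_supportGap (hμ : μ ∈ K) (hs : 0 ≤ s) (ht : 0 ≤ t) :
    ∫ x, supportGap K μ s t x ∂(stdGaussian (EuclideanSpace ℝ (Fin n))) =
      localWidth K μ t - localWidth K μ s :=
  integral_sub (integrable_localized_supportFn hμ ht) (integrable_localized_supportFn hμ hs)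

theorem variance_supportGap_le (hμ : μ ∈ K) (hs : 0 ≤ s) (ht : 0 ≤ t) :
    Var[supportGap K μ s t; stdGaussian (EuclideanSpace ℝ (Fin n))] ≤ 10 * (s ^ 2 + t ^ 2) := by
  obtain ⟨c1, l1⟩ := localized_supportFn_convex_lipschitz hμ ht
  obtain ⟨c2, l2⟩ := localized_supportFn_convex_lipschitz hμ hs
  have v1 := c1.variance_stdGaussian_le l1
  have v2 := c2.variance_stdGaussian_le l2
  rw [Real.coe_toNNReal _ ht] at v1
  rw [Real.coe_toNNReal _ hs] at v2
  have h1 := variance_sub l1.memLp_two_stdGaussian l2.memLp_two_stdGaussian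
  have h2 := variance_add l1.memLp_two_stdGaussian l2.memLp_two_stdGaussian
  -- The gap need not be convex, so its variance is bounded by twice the sum of the two variances,
  -- dropping the variance of the sum.
  have h3 := variance_nonneg ((fun x => supportFn (Metric.closedBall μ t ∩ K) x - inner ℝ x μ) +
    (fun x => supportFn (Metric.closedBall μ s ∩ K) x - inner ℝ x μ))
    (stdGaussian (EuclideanSpace ℝ (Fin n)))
  rw [supportGap_eq]
  linarith

theorem lseRisk_le_of_width_gap_le (hcl : IsClosed K) (hcv : Convex ℝ K) (hμ : μ ∈ K) {σ : ℝ}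
    (hσ : 0 < σ) (hs : 0 < s) (hst : s < t) {M : ℝ}
    (hM : localWidth K μ t - localWidth K μ s ≤ M) :
    lseRisk K σ μ ≤ ENNReal.ofReal
      (t ^ 2 + (2 * σ / (t - s)) ^ 2 * (10 * (s ^ 2 + t ^ 2) + M ^ 2)) := by
  have ht : 0 < t := hs.trans hst
  set γ := stdGaussian (EuclideanSpace ℝ (Fin n))
  set D := supportGap K μ s t
  have hD : MemLp D 2 γ := memLp_supportGap hμ hs.le ht.le
  have hD0 : ∀ x, 0 ≤ D x := supportGap_nonneg hμ hs.le hst.le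
  have hm := integral_supportGap hμ hs.le ht.le
  have hm0 : 0 ≤ ∫ x, D x ∂γ := integral_nonneg hD0
  have hsq : ∫ x, D x ^ 2 ∂γ ≤ 10 * (s ^ 2 + t ^ 2) + M ^ 2 := by
    have h1 := variance_eq_sub hD
    have h2 := variance_supportGap_le hμ hs.le ht.le
    have h3 : (∫ x, D x ∂γ) ^ 2 ≤ M ^ 2 := by
      gcongr
      exact hm.trans_le hM
    have h4 : ∫ x, (D ^ 2) x ∂γ = ∫ x, D x ^ 2 ∂γ := rfl
    rw [h4] at h1
    linarith
  calc lseRisk K σ μ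
      ≤ ∫⁻ x, ENNReal.ofReal (t ^ 2 + (2 * σ / (t - s)) ^ 2 * D x ^ 2) ∂γ := by
        refine lintegral_mono fun x => ENNReal.ofReal_le_ofReal ?_
        rcases le_total t ‖lse K (μ + σ • x) - μ‖ with h | h
        · have h1 := lse_error_le_of_ge hcl hcv hμ hσ x hs.le hst h
          calc _ ≤ (2 * σ / (t - s) * D x) ^ 2 := by gcongr; exact h1
            _ ≤ _ := by rw [mul_pow]; nlinarith
        · have : 0 ≤ (2 * σ / (t - s)) ^ 2 * D x ^ 2 := by positivity
          have : ‖lse K (μ + σ • x) - μ‖ ^ 2 ≤ t ^ 2 := by gcongr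
          linarith
    _ = ENNReal.ofReal (t ^ 2 + (2 * σ / (t - s)) ^ 2 * ∫ x, D x ^ 2 ∂γ) := by
        have hint : Integrable (fun x => t ^ 2 + (2 * σ / (t - s)) ^ 2 * D x ^ 2) γ :=
          (integrable_const _).add (hD.integrable_sq.const_mul _)
        rw [← ofReal_integral_eq_lintegral_ofReal hint (ae_of_all _ fun x => by positivity),
          integral_add (integrable_const _) (hD.integrable_sq.const_mul _), integral_const_mul]
        simp
    _ ≤ _ := by gcongr

theorem le_lseRisk_of_le_width_gap (hcl : IsClosed K) (hcv : Convex ℝ K) (hμ : μ ∈ K) {σ : ℝ}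
    (hσ : 0 < σ) (hs : 0 < s) (hst : s < t) {m : ℝ} (hm0 : 0 < m)
    (hm : m ≤ localWidth K μ t - localWidth K μ s) (hlarge : 80 * (s ^ 2 + t ^ 2) ≤ m ^ 2) :
    ENNReal.ofReal (min s (σ * m / (2 * (t - s))) ^ 2 / 2) ≤ lseRisk K σ μ := by
  have ht : 0 < t := hs.trans hst
  set γ := stdGaussian (EuclideanSpace ℝ (Fin n))
  set D := supportGap K μ s t
  set q := min s (σ * m / (2 * (t - s)))
  have hts : 0 < t - s := by linarith
  have hq : 0 ≤ q := le_min hs.le (by positivity)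
  have hD : MemLp D 2 γ := memLp_supportGap hμ hs.le ht.le
  have hmean : m ≤ ∫ x, D x ∂γ := hm.trans_eq (integral_supportGap hμ hs.le ht.le).symm
  set A := {x | m / 2 ≤ |D x - ∫ x, D x ∂γ|}
  have hDc : Continuous D := continuous_supportGap hμ hs.le ht.le
  have hA : MeasurableSet A :=
    measurableSet_le measurable_const ((hDc.sub continuous_const).abs.measurable)
  -- Chebyshev: `hlarge` makes the variance at most `m² / 8`, half of `(m / 2)²`.
  have hAle : γ A ≤ ENNReal.ofReal (1 / 2) := by
    refine (meas_ge_le_variance_div_sq hD (half_pos hm0)).trans (ENNReal.ofReal_le_ofReal ?_)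
    rw [div_le_iff₀ (by positivity)]
    have := variance_supportGap_le hμ hs.le ht.le
    nlinarith
  have hAc : ENNReal.ofReal (1 / 2) ≤ γ Aᶜ := by
    rw [prob_compl_eq_one_sub hA]
    refine le_trans ?_ (tsub_le_tsub_left hAle 1)
    rw [← ENNReal.ofReal_one, ← ENNReal.ofReal_sub _ (by norm_num)]
    norm_num
  have hr : ∀ x ∈ Aᶜ, q ≤ ‖lse K (μ + σ • x) - μ‖ := by
    intro x hx
    simp only [A, Set.mem_compl_iff, Set.mem_ofPred_eq, not_le] at hx
    have hDx : m / 2 ≤ D x := by linarith [(abs_lt.1 hx).1]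
    by_contra! hlt
    have h1 : ‖lse K (μ + σ • x) - μ‖ < s := hlt.trans_le (min_le_left _ _)
    have h2 := hlt.trans_le (min_le_right s (σ * m / (2 * (t - s))))
    have h3 := supportFn_gap_le_of_lse_error_lt hcl hcv hμ hσ x hst.le h1
    have h4 := hDx.trans h3
    rw [le_div_iff₀ hσ] at h4
    rw [lt_div_iff₀ (by positivity)] at h2
    linarith
  calc ENNReal.ofReal (q ^ 2 / 2) = ENNReal.ofReal (q ^ 2) * ENNReal.ofReal (1 / 2) := by
        rw [← ENNReal.ofReal_mul (by positivity)]; ring_nf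
    _ ≤ ENNReal.ofReal (q ^ 2) * γ Aᶜ := by gcongr
    _ = ∫⁻ _ in Aᶜ, ENNReal.ofReal (q ^ 2) ∂γ := by rw [setLIntegral_const]
    _ ≤ ∫⁻ x in Aᶜ, ENNReal.ofReal (‖lse K (μ + σ • x) - μ‖ ^ 2) ∂γ :=
        setLIntegral_mono' hA.compl fun x hx => by gcongr; exact hr x hx
    _ ≤ lseRisk K σ μ := setLIntegral_le_lintegral _ _

end Gap

/-! ### Le Cam's two-point lower bound. -/

section TwoPoint

variable {n : ℕ} {K : Set (EuclideanSpace ℝ (Fin n))}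

theorem exists_le_lseRisk_of_two_points (hne : K.Nonempty) (hcl : IsClosed K) (hcv : Convex ℝ K)
    {σ : ℝ} (hσ : 0 < σ) {μ₀ μ₁ : EuclideanSpace ℝ (Fin n)} (h₀ : μ₀ ∈ K) (h₁ : μ₁ ∈ K)
    (hle : ‖μ₁ - μ₀‖ ≤ σ) :
    ∃ μ ∈ K, ENNReal.ofReal (‖μ₁ - μ₀‖ ^ 2 / 48) ≤ lseRisk K σ μ := by
  set γ := stdGaussian (EuclideanSpace ℝ (Fin n))
  set δ := ‖μ₁ - μ₀‖
  have hcont : Continuous (lse K) := (lipschitzWith_lse hne hcl hcv).continuous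
  set B : EuclideanSpace ℝ (Fin n) → Set (EuclideanSpace ℝ (Fin n)) :=
    fun μ => {x | δ / 2 ≤ ‖lse K (μ + σ • x) - μ‖} with hB
  have hBm : ∀ μ, MeasurableSet (B μ) := fun μ =>
    measurableSet_le measurable_const (Continuous.measurable (by fun_prop))
  have hrisk : ∀ μ, 1 / 12 ≤ γ.real (B μ) → ENNReal.ofReal (δ ^ 2 / 48) ≤ lseRisk K σ μ := by
    intro μ hμ
    calc ENNReal.ofReal (δ ^ 2 / 48) = ENNReal.ofReal ((δ / 2) ^ 2) * ENNReal.ofReal (1 / 12) := by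
          rw [← ENNReal.ofReal_mul (by positivity)]; ring_nf
      _ ≤ ENNReal.ofReal ((δ / 2) ^ 2) * γ (B μ) := by
          gcongr
          exact ENNReal.ofReal_le_of_le_toReal hμ
      _ = ∫⁻ _ in B μ, ENNReal.ofReal ((δ / 2) ^ 2) ∂γ := by rw [setLIntegral_const]
      _ ≤ ∫⁻ x in B μ, ENNReal.ofReal (‖lse K (μ + σ • x) - μ‖ ^ 2) ∂γ :=
          setLIntegral_mono' (hBm μ) fun x hx => by
            have : δ / 2 ≤ ‖lse K (μ + σ • x) - μ‖ := hx
            gcongr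
      _ ≤ lseRisk K σ μ := setLIntegral_le_lintegral _ _
  set θ := σ⁻¹ • (μ₁ - μ₀)
  have hθ : ‖θ‖ ≤ 1 := by
    rw [norm_smul, norm_inv, Real.norm_of_nonneg hσ.le, inv_mul_le_iff₀ hσ, mul_one]
    exact hle
  -- The same observation arises from `μ₁` with noise `x` and from `μ₀` with noise `x + θ`; one
  -- estimate cannot be within `δ / 2` of both means.
  have hcover : Set.univ ⊆ B μ₁ ∪ (fun x => x + θ) ⁻¹' B μ₀ := by
    intro x _
    by_contra hx
    simp only [hB, Set.mem_union, Set.mem_ofPred_eq, Set.mem_preimage, not_or, not_le] at hx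
    have e : μ₀ + σ • (x + θ) = μ₁ + σ • x := by
      rw [smul_add, smul_inv_smul₀ hσ.ne']; abel
    rw [e] at hx
    have := norm_sub_le (lse K (μ₁ + σ • x) - μ₀) (lse K (μ₁ + σ • x) - μ₁)
    rw [sub_sub_sub_cancel_left] at this
    change δ ≤ _ at this
    linarith
  have hsum : 1 ≤ γ.real (B μ₁) + γ.real ((fun x => x + θ) ⁻¹' B μ₀) := by
    have h1 : γ.real Set.univ ≤ _ := measureReal_mono hcover
    rw [probReal_univ] at h1
    exact h1.trans (measureReal_union_le _ _)
  have hsq : γ.real ((fun x => x + θ) ⁻¹' B μ₀) ^ 2 ≤ γ.real (B μ₀) * 3 := by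
    have h1 := ENNReal.toReal_mono (ENNReal.mul_ne_top (measure_ne_top _ _) ENNReal.ofReal_ne_top)
      (stdGaussian_shift_sq_le θ (hBm μ₀))
    rw [ENNReal.toReal_pow, ENNReal.toReal_mul, ENNReal.toReal_ofReal (by positivity)] at h1
    refine h1.trans ?_
    have h2 : Real.exp (‖θ‖ ^ 2) ≤ 3 := by
      have : Real.exp (‖θ‖ ^ 2) ≤ Real.exp 1 :=
        Real.exp_le_exp.2 (pow_le_one₀ (norm_nonneg _) hθ)
      linarith [Real.exp_one_lt_d9]
    exact mul_le_mul_of_nonneg_left h2 measureReal_nonneg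
  by_cases h : 1 / 12 ≤ γ.real (B μ₁)
  · exact ⟨μ₁, h₁, hrisk _ h⟩
  · refine ⟨μ₀, h₀, hrisk _ ?_⟩
    -- The shifted event now has probability above `11/12`, and `(11/12)² / 3 > 1/12`.
    push Not at h
    nlinarith

end TwoPoint

/-! ### From risks to the worst case rate. -/

section WorstRate

variable {n : ℕ} {K : Set (EuclideanSpace ℝ (Fin n))} {σ : ℝ}

theorem ennreal_sq_rpow_half (q : ℝ≥0∞) : (q ^ 2) ^ (1 / 2 : ℝ) = q := by
  rw [← ENNReal.rpow_two, ← ENNReal.rpow_mul]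
  norm_num

theorem le_lseWorstRate {μ : EuclideanSpace ℝ (Fin n)} (hμ : μ ∈ K) {q : ℝ≥0∞}
    (h : q ^ 2 ≤ lseRisk K σ μ) : q ≤ lseWorstRate K σ := by
  rw [← ennreal_sq_rpow_half q]
  exact ENNReal.rpow_le_rpow (h.trans (le_iSup₂ (f := fun μ _ => lseRisk K σ μ) μ hμ))
    (by norm_num)

theorem lseWorstRate_le {q : ℝ≥0∞} (h : ∀ μ ∈ K, lseRisk K σ μ ≤ q ^ 2) :
    lseWorstRate K σ ≤ q := by
  rw [← ennreal_sq_rpow_half q]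
  exact ENNReal.rpow_le_rpow (iSup₂_le h) (by norm_num)

theorem lseWorstRate_le_ediam (hne : K.Nonempty) (hcl : IsClosed K) :
    lseWorstRate K σ ≤ Metric.ediam K := by
  refine lseWorstRate_le fun μ hμ => ?_
  have h : ∀ x, ENNReal.ofReal (‖lse K (μ + σ • x) - μ‖ ^ 2) ≤ Metric.ediam K ^ 2 := fun x => by
    rw [ENNReal.ofReal_pow (norm_nonneg _), ← dist_eq_norm, ← edist_dist]
    gcongr
    exact Metric.edist_le_ediam_of_mem (lse_spec hne hcl _).1 hμ
  calc _ ≤ ∫⁻ _, Metric.ediam K ^ 2 ∂(stdGaussian (EuclideanSpace ℝ (Fin n))) :=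
        lintegral_mono h
    _ = _ := by simp

/-- `ε` belongs to the set whose supremum is `widthGapRate K C c σ`. -/
def IsWidthGapFeasible (K : Set (EuclideanSpace ℝ (Fin n))) (C c σ ε : ℝ) : Prop :=
  0 ≤ ε ∧ (((C ^ 2 - c ^ 2) * ε ^ 2 / (2 * σ) : ℝ) : EReal) ≤
    ⨆ μ ∈ K, ((localWidth K μ (C * ε) - localWidth K μ (c * ε) : ℝ) : EReal)

variable {C c : ℝ}

theorem lt_widthGapRate_iff {r : ℝ≥0∞} :
    r < widthGapRate K C c σ ↔ ∃ ε, IsWidthGapFeasible K C c σ ε ∧ r < ENNReal.ofReal ε := by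
  simp only [widthGapRate, lt_iSup_iff, IsWidthGapFeasible, exists_prop]

theorem le_widthGapRate {ε : ℝ} (h : IsWidthGapFeasible K C c σ ε) :
    ENNReal.ofReal ε ≤ widthGapRate K C c σ :=
  le_iSup₂ (f := fun (ε : ℝ) (_ : IsWidthGapFeasible K C c σ ε) => ENNReal.ofReal ε) ε h

theorem lseWorstRate_le_of_widthGapRate_lt (hcl : IsClosed K) (hcv : Convex ℝ K) (hc : 0 < c)
    (hcC : c < C) (hσ : 0 < σ) {ε : ℝ} (hε : 0 < ε)
    (hlt : widthGapRate K C c σ < ENNReal.ofReal ε) :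
    lseWorstRate K σ ≤ ENNReal.ofReal
      (√(C ^ 2 + (C + c) ^ 2 + 40 * (C ^ 2 + c ^ 2) / (C - c) ^ 2) * (ε + σ)) := by
  have hnot : ¬ IsWidthGapFeasible K C c σ ε := fun h => hlt.not_ge (le_widthGapRate h)
  have hcC' : 0 < C - c := by linarith
  refine lseWorstRate_le fun μ hμ => ?_
  have hgap : localWidth K μ (C * ε) - localWidth K μ (c * ε) ≤
      (C ^ 2 - c ^ 2) * ε ^ 2 / (2 * σ) := by
    by_contra! h
    refine hnot ⟨hε.le, (EReal.coe_le_coe_iff.2 h.le).trans ?_⟩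
    exact le_iSup₂ (f := fun μ (_ : μ ∈ K) =>
      ((localWidth K μ (C * ε) - localWidth K μ (c * ε) : ℝ) : EReal)) μ hμ
  refine (lseRisk_le_of_width_gap_le hcl hcv hμ hσ (s := c * ε) (t := C * ε) (by positivity)
    (by gcongr) hgap).trans ?_
  rw [← ENNReal.ofReal_pow (by positivity), mul_pow √_, Real.sq_sqrt (by positivity)]
  refine ENNReal.ofReal_le_ofReal ?_
  have e : (C * ε) ^ 2 + (2 * σ / (C * ε - c * ε)) ^ 2 *
      (10 * ((c * ε) ^ 2 + (C * ε) ^ 2) + ((C ^ 2 - c ^ 2) * ε ^ 2 / (2 * σ)) ^ 2) =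
      (C ^ 2 + (C + c) ^ 2) * ε ^ 2 + 40 * (C ^ 2 + c ^ 2) / (C - c) ^ 2 * σ ^ 2 := by
    rw [← sub_mul]
    field_simp
    ring
  rw [e, add_mul _ _ ((ε + σ) ^ 2)]
  have h1 : ε ^ 2 ≤ (ε + σ) ^ 2 := by gcongr; linarith
  have h2 : σ ^ 2 ≤ (ε + σ) ^ 2 := by gcongr; linarith
  gcongr

theorem le_lseWorstRate_of_feasible (hcl : IsClosed K) (hcv : Convex ℝ K) (hc : 0 < c)
    (hcC : c < C) (hσ : 0 < σ) {ε : ℝ} (hε : 0 < ε) (hf : IsWidthGapFeasible K C c σ ε)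
    (hlarge : 52 * C / (C ^ 2 - c ^ 2) * σ ≤ ε) :
    ENNReal.ofReal (c / 6 * ε) ≤ lseWorstRate K σ := by
  have hC : 0 < C := hc.trans hcC
  have hcC' : 0 < C - c := by linarith
  have hsq : 0 < C ^ 2 - c ^ 2 := by nlinarith
  -- Half of the feasibility threshold: the supremum over `μ` need not be attained, but some `μ`
  -- exceeds `m`.
  set m := (C ^ 2 - c ^ 2) * ε ^ 2 / (4 * σ) with hm
  have hm0 : 0 < m := by positivity
  have hlt : (m : EReal) <
      ⨆ μ ∈ K, ((localWidth K μ (C * ε) - localWidth K μ (c * ε) : ℝ) : EReal) := by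
    refine lt_of_lt_of_le (EReal.coe_lt_coe_iff.2 ?_) hf.2
    rw [hm, div_lt_div_iff_of_pos_left (by positivity) (by positivity) (by positivity)]
    linarith
  simp only [lt_iSup_iff, exists_prop] at hlt
  obtain ⟨μ, hμ, hgap⟩ := hlt
  have hgap' := (EReal.coe_lt_coe_iff.1 hgap).le
  -- Here `13 = 52 / 4`, and `13² ≥ 160` yields the Chebyshev condition `80 (c² + C²) ε² ≤ m²`.
  have h13 : 13 * C * ε ≤ m := by
    rw [div_mul_eq_mul_div, div_le_iff₀ hsq] at hlarge
    rw [hm, le_div_iff₀ (by positivity)]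
    nlinarith
  refine le_lseWorstRate hμ ((le_trans ?_) (le_lseRisk_of_le_width_gap hcl hcv hμ hσ
    (s := c * ε) (t := C * ε) (by positivity) (by gcongr) hm0 hgap' ?_))
  · rw [← ENNReal.ofReal_pow (by positivity)]
    refine ENNReal.ofReal_le_ofReal ?_
    have hq : c / 4 * ε ≤ min (c * ε) (σ * m / (2 * (C * ε - c * ε))) := by
      refine le_min (by nlinarith) ?_
      have e : σ * m / (2 * (C * ε - c * ε)) = (C + c) / 8 * ε := by
        rw [hm, ← sub_mul]
        field_simp
        ring
      rw [e]
      gcongr ?_ * ε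
      linarith
    calc (c / 6 * ε) ^ 2 ≤ (c / 4 * ε) ^ 2 / 2 := by nlinarith [sq_nonneg (c * ε)]
      _ ≤ _ := by gcongr
  · have h1 : (13 * C * ε) ^ 2 ≤ m ^ 2 := by gcongr
    have h2 : (c * ε) ^ 2 ≤ (C * ε) ^ 2 := by gcongr
    nlinarith [sq_nonneg (C * ε)]

theorem le_lseWorstRate_min_ediam (hne : K.Nonempty) (hcl : IsClosed K) (hcv : Convex ℝ K)
    (hσ : 0 < σ) :
    ENNReal.ofReal (1 / 14) * min (ENNReal.ofReal σ) (Metric.ediam K) ≤ lseWorstRate K σ := by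
  set d := min (ENNReal.ofReal σ) (Metric.ediam K)
  have hdtop : d ≠ ∞ := ne_top_of_le_ne_top ENNReal.ofReal_ne_top (min_le_left _ _)
  rcases eq_or_ne d 0 with h0 | h0
  · simp [h0]
  have hδ : d.toReal = min σ d.toReal := by
    refine (min_eq_right ?_).symm
    exact ENNReal.toReal_le_of_le_ofReal hσ.le (min_le_left _ _)
  set δ := d.toReal
  have hδ0 : 0 < δ := ENNReal.toReal_pos h0 hdtop
  have hδσ : δ ≤ σ := hδ ▸ min_le_left _ _
  have hhalf : ENNReal.ofReal (δ / 2) < Metric.ediam K := by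
    refine lt_of_lt_of_le ?_ (min_le_right (ENNReal.ofReal σ) _)
    rw [ENNReal.ofReal_lt_iff_lt_toReal (by positivity) hdtop]
    exact half_lt_self hδ0
  obtain ⟨p, hp, q, hq, hpq⟩ : ∃ p ∈ K, ∃ q ∈ K, δ / 2 < dist p q := by
    by_contra! h
    refine hhalf.not_ge (Metric.ediam_le fun p hp q hq => ?_)
    rw [edist_dist]
    exact ENNReal.ofReal_le_ofReal (h p hp q hq)
  rw [dist_comm, dist_eq_norm] at hpq
  -- The two means must be within `σ`, so `q` is moved along the segment to distance exactly `δ / 2`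
  -- from `p`.
  set l := (δ / 2) / ‖q - p‖ with hl
  have hnpos : 0 < ‖q - p‖ := lt_trans (by positivity) hpq
  have hl0 : 0 ≤ l := by positivity
  have hl1 : l ≤ 1 := (div_le_one hnpos).2 hpq.le
  have hr : p + l • (q - p) ∈ K := hcv.add_smul_sub_mem hp hq ⟨hl0, hl1⟩
  have hnorm : ‖p + l • (q - p) - p‖ = δ / 2 := by
    rw [add_sub_cancel_left, norm_smul, Real.norm_of_nonneg hl0, hl, div_mul_cancel₀ _ hnpos.ne']
  obtain ⟨μ, hμ, h⟩ := exists_le_lseRisk_of_two_points hne hcl hcv hσ hp hr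
    (by rw [hnorm]; linarith)
  refine le_lseWorstRate hμ (le_trans ?_ h)
  rw [hnorm, ← ENNReal.ofReal_toReal hdtop, ← ENNReal.ofReal_mul (by norm_num),
    ← ENNReal.ofReal_pow (by positivity)]
  refine ENNReal.ofReal_le_ofReal ?_
  change (1 / 14 * δ) ^ 2 ≤ _
  nlinarith [sq_nonneg δ]

theorem le_lseWorstRate_widthGapRate (hcl : IsClosed K) (hcv : Convex ℝ K) (hc : 0 < c)
    (hcC : c < C) (hσ : 0 < σ)
    (hlarge : ENNReal.ofReal (52 * C / (C ^ 2 - c ^ 2) * σ) < widthGapRate K C c σ) :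
    ENNReal.ofReal (c / 6) * widthGapRate K C c σ ≤ lseWorstRate K σ := by
  have hpos : 0 < 52 * C / (C ^ 2 - c ^ 2) * σ := by
    have : 0 < C ^ 2 - c ^ 2 := by nlinarith
    have : 0 < C := hc.trans hcC
    positivity
  have hbig : ∀ r, r < widthGapRate K C c σ →
      ENNReal.ofReal (52 * C / (C ^ 2 - c ^ 2) * σ) ≤ r →
      ENNReal.ofReal (c / 6) * r ≤ lseWorstRate K σ := by
    intro r hr hr'
    obtain ⟨ε, hf, hlt⟩ := lt_widthGapRate_iff.1 hr
    have h1 : 52 * C / (C ^ 2 - c ^ 2) * σ < ε :=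
      (ENNReal.ofReal_lt_ofReal_iff_of_nonneg hpos.le).1 (hr'.trans_lt hlt)
    have h2 := le_lseWorstRate_of_feasible hcl hcv hc hcC hσ (hpos.trans h1) hf h1.le
    rw [ENNReal.ofReal_mul (by positivity)] at h2
    exact (mul_le_mul_right hlt.le _).trans h2
  have hne0 : ENNReal.ofReal (c / 6) ≠ 0 := by simpa using hc
  rw [mul_comm, ← ENNReal.le_div_iff_mul_le (Or.inl hne0) (Or.inl ENNReal.ofReal_ne_top)]
  refine le_of_forall_lt fun r hr => ?_
  -- Raising `r` above the threshold provides a feasible `ε` that is large enough, even if the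
  -- supremum is infinite or not attained.
  obtain ⟨r', h1, h2⟩ := exists_between (max_lt hr hlarge)
  refine ((le_max_left _ _).trans_lt h1).trans_le ?_
  rw [ENNReal.le_div_iff_mul_le (Or.inl hne0) (Or.inl ENNReal.ofReal_ne_top), mul_comm]
  exact hbig r' h2 ((le_max_right _ _).trans h1.le)

end WorstRate

/-! ### The two regimes. -/

theorem theorem2p13 (C c : ℝ) (hc : 0 < c) (hc1 : c < 1) (hC : 1 < C) :
    ∃ κ₀ : ℝ≥0, 0 < κ₀ ∧ ∀ κ : ℝ≥0, κ₀ ≤ κ → ∃ a b : ℝ≥0, 0 < a ∧ 0 < b ∧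
      ∀ (n : ℕ) (K : Set (EuclideanSpace ℝ (Fin n))) (σ : ℝ),
        K.Nonempty → IsClosed K → Convex ℝ K → 0 < σ →
        (κ * ENNReal.ofReal σ ≤ widthGapRate K C c σ →
          a * widthGapRate K C c σ ≤ lseWorstRate K σ ∧
          lseWorstRate K σ ≤ b * widthGapRate K C c σ) ∧
        (widthGapRate K C c σ < κ * ENNReal.ofReal σ →
          a * min (ENNReal.ofReal σ) (Metric.ediam K) ≤ lseWorstRate K σ ∧
          lseWorstRate K σ ≤ b * min (ENNReal.ofReal σ) (Metric.ediam K)) := by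
  have hcC : c < C := hc1.trans hC
  have hsq : 0 < C ^ 2 - c ^ 2 := by nlinarith
  set k : ℝ := 52 * C / (C ^ 2 - c ^ 2)
  have hk : 0 < k := by positivity
  set A : ℝ := √(C ^ 2 + (C + c) ^ 2 + 40 * (C ^ 2 + c ^ 2) / (C - c) ^ 2)
  have hA : 0 < A := by positivity
  -- The factor `2` turns `κ σ ≤ widthGapRate` into the strict bound `k σ < widthGapRate`.
  refine ⟨(2 * k).toNNReal, by positivity, fun κ hκ => ?_⟩
  have hκ' : 2 * k ≤ κ := Real.toNNReal_le_iff_le_coe.1 hκ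
  have hκ0 : (0 : ℝ) < κ := by linarith
  -- The entries serve the diameter bound, the infeasible radius `2 w` in the first regime, and the
  -- infeasible radius `κ σ` in the second.
  set b : ℝ := max 1 (max (A * (2 + 1 / κ)) (A * (κ + 1)))
  have hb : 0 < b := lt_of_lt_of_le one_pos (le_max_left _ _)
  refine ⟨(min (c / 6) (1 / 14)).toNNReal, b.toNNReal, by positivity, by positivity,
    fun n K σ hne hcl hcv hσ => ?_⟩
  have hκσ : (κ : ℝ≥0∞) * ENNReal.ofReal σ = ENNReal.ofReal (κ * σ) := by
    rw [ENNReal.ofReal_mul κ.coe_nonneg, ENNReal.ofReal_coe_nnreal]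
  have hae : ((min (c / 6) (1 / 14)).toNNReal : ℝ≥0∞) = ENNReal.ofReal (min (c / 6) (1 / 14)) := rfl
  have hbe : (b.toNNReal : ℝ≥0∞) = ENNReal.ofReal b := rfl
  rw [hκσ, hae, hbe]
  refine ⟨fun h => ⟨?_, ?_⟩, fun h => ⟨?_, ?_⟩⟩
  · refine le_trans ?_ (le_lseWorstRate_widthGapRate hcl hcv hc hcC hσ (lt_of_lt_of_le ?_ h))
    · gcongr
      exact min_le_left _ _
    · rw [ENNReal.ofReal_lt_ofReal_iff (by positivity)]
      change k * σ < _
      nlinarith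
  · rcases eq_or_ne (widthGapRate K C c σ) ∞ with htop | htop
    · rw [htop, ENNReal.mul_top (by simpa using hb)]
      exact le_top
    set w := (widthGapRate K C c σ).toReal
    have hw : widthGapRate K C c σ = ENNReal.ofReal w := (ENNReal.ofReal_toReal htop).symm
    have hκw : κ * σ ≤ w := (ENNReal.ofReal_le_iff_le_toReal htop).1 h
    have hw0 : 0 < w := lt_of_lt_of_le (by positivity) hκw
    have h1 := lseWorstRate_le_of_widthGapRate_lt hcl hcv hc hcC hσ (ε := 2 * w) (by positivity)
      (by rw [hw, ENNReal.ofReal_lt_ofReal_iff (by positivity)]; linarith)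
    refine h1.trans ?_
    rw [hw, ← ENNReal.ofReal_mul hb.le]
    refine ENNReal.ofReal_le_ofReal ?_
    change A * _ ≤ _
    have h2 : σ ≤ 1 / κ * w := by rw [div_mul_eq_mul_div, le_div_iff₀ hκ0]; linarith
    calc A * (2 * w + σ) ≤ A * (2 * w + 1 / κ * w) := by gcongr
      _ = A * (2 + 1 / κ) * w := by ring
      _ ≤ b * w := by
        gcongr
        exact (le_max_left _ _).trans (le_max_right _ _)
  · refine le_trans ?_ (le_lseWorstRate_min_ediam hne hcl hcv hσ)
    gcongr
    exact min_le_right _ _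
  · rcases min_choice (ENNReal.ofReal σ) (Metric.ediam K) with hmin | hmin <;> rw [hmin]
    · refine (lseWorstRate_le_of_widthGapRate_lt hcl hcv hc hcC hσ (by positivity) h).trans ?_
      rw [← ENNReal.ofReal_mul hb.le]
      refine ENNReal.ofReal_le_ofReal ?_
      calc A * (κ * σ + σ) = A * (κ + 1) * σ := by ring
        _ ≤ b * σ := by
          gcongr
          exact (le_max_right _ _).trans (le_max_right _ _)
    · refine (lseWorstRate_le_ediam hne hcl).trans (le_mul_of_one_le_left' ?_)
      rw [← ENNReal.ofReal_one]
      exact ENNReal.ofReal_le_ofReal (le_max_left _ _)
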